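/- All links are unoriented and considered up to isotopy. For integers $a_1,\dots,a_n$ the rational tangle $a_1a_2\cdots a_n$ (Conway notation) is the one with slope given by the continued fraction $$[a_1,\dots,a_n]=\cfrac{1}{a_n+\cfrac{1}{a_{n-1}+\cfrac{1}{\ddots+\cfrac{1}{a_1}}}}.$$ For coprime integers $\alpha_i>1$ and $\beta_i$, the Montesinos link $M(e;(\alpha_1,\beta_1),\dots,(\alpha_r,\beta_r))$ is obtained by arranging cyclically the rational tangles of slopes $\beta_1/\alpha_1,\dots,\beta_r/\alpha_r$ together with $e$ half twists, each opposite to the tangle of slope $1$ (so that $e-\sum_i\beta_i/\alpha_i$ is an invariant of the link). The description is in standard form if $0<\beta_i/\alpha_i<1$ for all $i$. We say that a link falls into the third case through a description $M(e;(\alpha_1,\beta_1),\dots,(\alpha_r,\beta_r))$ of it if this description is in standard form, $e=1$, and for some $i$ $$\frac{\alpha_i}{\alpha_i-\beta_i}>\min\Big\{\frac{\alpha_j}{\beta_j}\ \Big|\ j\neq i\Big\}.$$ For rational tangles $A,R,C$ let $L(A,R,C)$ denote the Montesinos link built cyclically from $A,R,C$ with $e=0$. **Proposition (Widmar's classes fall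 into the third case).** Let $R$ be a rational tangle of slope $\beta/\alpha$ with $\alpha>1$ and $\beta$ coprime and $0<\beta/\alpha<1$, and let all $a_i$, $c_i$ and $n$ be positive integers. 1. If $1+a_1(a_2-n)<0$, then $L(a_1a_2,R,-n)$ falls into the third case through the description $$M\big(1;(a_1a_2+1,a_1),(\alpha,\beta),(n,n-1)\big).$$ 2. If $a_2\le c_2$ and $a_1>c_1$, then $L(a_1a_2,R,(-c_1)(-c_2))$ falls into the third case through the description $$M\big(1;(a_1a_2+1,a_1),(\alpha,\beta),(c_1c_2+1,\,c_1c_2+1-c_1)\big).$$ 3. If $a_3<n$, then $L(a_1a_2a_3,R,-n)$ falls into the third case through the description $$M\big(1;(a_1a_2a_3+a_1+a_3,\,a_1a_2+1),(\alpha,\beta),(n,n-1)\big).$$ 4. If $\dfrac{1+a_1a_2}{1+c_1c_2}>\dfrac{a_1+a_3+a_1a_2a_3}{c_1+c_3+c_1c_2c_3}$, then $L(a_1a_2a_3,R,(-c_1)(-c_2)(-c_3))$ falls into the third case through the description $$M\big(1;(a_1a_2a_3+a_1+a_3,\,a_1a_2+1),(\alpha,\beta),(c_1c_2c_3+c_1+c_3,\,c_1c_2c_3+c_1+c_3-(c_1c_2+1))\big).$$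 -/

import Mathlib

namespace Montesinos

/-! ### Sliced (Morse) diagrams of unoriented tangles and links

A diagram is drawn in the plane in generic position with respect to the height and is read from
bottom to top, as a sequence of elementary slices.  Each slice contains one elementary piece, and
vertical strands to the left and to the right of it. -/

/-- The elementary pieces: a local minimum, a local maximum, and the two crossings.  In `cross true`
the strand running from bottom left to top right is the upper one, in `cross false` it is the
lower one. -/
inductive Piece : Type
  | cup : Piece
  | cap : Piece
  | cross : Bool → Piece
  deriving DecidableEq

/-- Number of strands entering a piece from below. -/
def Piece.ins : Piece → ℕ
  | .cup => 0
  | .cap => 2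
  | .cross _ => 2

/-- Number of strands leaving a piece at the top. -/
def Piece.outs : Piece → ℕ
  | .cup => 2
  | .cap => 0
  | .cross _ => 2

/-- The crossing with upper and lower strand exchanged; cups and caps are unchanged. -/
def Piece.mirror : Piece → Piece
  | .cup => .cup
  | .cap => .cap
  | .cross s => .cross (!s)

/-- A slice: a piece with `pos` vertical strands to the left of it. -/
structure Slice : Type where
  piece : Piece
  pos : ℕ
  deriving DecidableEq

/-- A sequence of slices, from bottom to top. -/
abbrev Diagram : Type := List Slice

/-- The number of strands above the diagram `D` when `n` strands enter it from below; `none` if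
some slice needs strands that are not there. -/
def strands : Diagram → ℕ → Option ℕ
  | [], n => some n
  | x :: D, n =>
      if x.pos + x.piece.ins ≤ n then strands D (n - x.piece.ins + x.piece.outs) else none

/-- Tangle diagrams with `m` end points at the bottom and `n` end points at the top. -/
abbrev Tangle (m n : ℕ) : Type := {D : Diagram // strands D m = some n}

/-- Link diagrams are tangle diagrams without end points. -/
abbrev LinkDiagram : Type := Tangle 0 0

/-- The elementary moves for sliced diagrams: the planar isotopies (straightening a strand, exchange
of two distant pieces, sliding a strand over or under a local extremum) and the three Reidemeister
moves. -/
inductive Move : Diagram → Diagram → Prop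
  | straighten_right (i : ℕ) : Move [⟨.cup, i⟩, ⟨.cap, i + 1⟩] []
  | straighten_left (i : ℕ) : Move [⟨.cup, i + 1⟩, ⟨.cap, i⟩] []
  | exchange (p q : Piece) (i k : ℕ) :
      Move [⟨p, i⟩, ⟨q, i + p.outs + k⟩] [⟨q, i + p.ins + k⟩, ⟨p, i⟩]
  | slide_cup (s : Bool) (i : ℕ) :
      Move [⟨.cup, i⟩, ⟨.cross s, i + 1⟩] [⟨.cup, i + 1⟩, ⟨.cross (!s), i⟩]
  | slide_cap (s : Bool) (i : ℕ) :
      Move [⟨.cross s, i⟩, ⟨.cap, i + 1⟩] [⟨.cross (!s), i + 1⟩, ⟨.cap, i⟩]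
  | reidemeister_one_cup (s : Bool) (i : ℕ) : Move [⟨.cup, i⟩, ⟨.cross s, i⟩] [⟨.cup, i⟩]
  | reidemeister_one_cap (s : Bool) (i : ℕ) : Move [⟨.cross s, i⟩, ⟨.cap, i⟩] [⟨.cap, i⟩]
  | reidemeister_two (s : Bool) (i : ℕ) : Move [⟨.cross s, i⟩, ⟨.cross (!s), i⟩] []
  | reidemeister_three (s : Bool) (i : ℕ) :
      Move [⟨.cross s, i⟩, ⟨.cross s, i + 1⟩, ⟨.cross s, i⟩]
        [⟨.cross s, i + 1⟩, ⟨.cross s, i⟩, ⟨.cross s, i + 1⟩]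

/-- One elementary move performed inside a diagram.  Both sides are genuine diagrams, because `D`
and `D'` are. -/
def Step {m n : ℕ} (D D' : Tangle m n) : Prop :=
  ∃ below x y above : Diagram, Move x y ∧
    D.1 = below ++ x ++ above ∧ D'.1 = below ++ y ++ above

/-- Two diagrams represent the same (isotopic) tangles or links: they are connected by a finite
sequence of elementary moves and their inverses. -/
def Isotopic {m n : ℕ} (D D' : Tangle m n) : Prop := Relation.EqvGen Step D D'

/-! ### Operations on diagrams -/

/-- Add `k` vertical strands on the left. -/
def shift (k : ℕ) (D : Diagram) : Diagram := D.map fun x => ⟨x.piece, x.pos + k⟩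

theorem strands_append (D E : Diagram) (m : ℕ) :
    strands (D ++ E) m = (strands D m).bind (strands E) := by
  induction D generalizing m with
  | nil => rfl
  | cons x D ih =>
    simp only [List.cons_append, strands]
    split
    · exact ih _
    · rfl

theorem strands_shift (k r : ℕ) (D : Diagram) :
    ∀ m n : ℕ, strands D m = some n → strands (shift k D) (m + k + r) = some (n + k + r) := by
  induction D with
  | nil =>
    intro m n h
    simp only [strands, Option.some.injEq] at h
    simp [shift, strands, h]
  | cons x D ih =>
    intro m n h
    simp only [strands] at h
    split at h
    · rename_i hx
      have h2 := ih _ _ h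
      simp only [shift, List.map_cons, strands]
      rw [if_pos (by omega)]
      have e : m + k + r - x.piece.ins + x.piece.outs
          = m - x.piece.ins + x.piece.outs + k + r := by omega
      rw [e]
      exact h2
    · simp at h

theorem strands_mirror (D : Diagram) (m : ℕ) :
    strands (D.map fun x => ⟨x.piece.mirror, x.pos⟩) m = strands D m := by
  induction D generalizing m with
  | nil => rfl
  | cons x D ih =>
    obtain ⟨p, i⟩ := x
    simp only [List.map_cons, strands, ih]
    cases p <;> rfl

/-- The mirror image in the plane of the diagram: all crossings are changed. -/
def mirror {m n : ℕ} (T : Tangle m n) : Tangle m n :=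
  ⟨T.1.map fun x => ⟨x.piece.mirror, x.pos⟩, by rw [strands_mirror]; exact T.2⟩

/-- The second tangle placed on top of the first. -/
def glue {l m n : ℕ} (S : Tangle l m) (T : Tangle m n) : Tangle l n :=
  ⟨S.1 ++ T.1, by rw [strands_append, S.2]; exact T.2⟩

/-- The tangle consisting of two vertical strands. -/
def idTangle : Tangle 2 2 := ⟨[], rfl⟩

/-- Rotation by a quarter turn (clockwise) of a tangle with four end points: the bottom left end
becomes the top left one, and the top right end becomes the bottom right one. -/
def rotate (T : Tangle 2 2) : Tangle 2 2 :=
  ⟨[⟨.cup, 0⟩] ++ shift 1 T.1 ++ [⟨.cap, 2⟩], by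
    have h := strands_shift 1 1 T.1 2 2 T.2
    rw [strands_append, strands_append]
    have h0 : strands [⟨.cup, 0⟩] 2 = some 4 := rfl
    rw [h0]
    simp only [Option.bind_some]
    rw [h]
    rfl⟩

/-! ### Rational tangles

Pictures are turned by a quarter turn compared with the usual ones: tangles are added by putting
them on top of each other, so that the tangle of slope `0` is `idTangle`. -/

/-- `|a|` half twists of the two vertical strands: the integer tangle of slope `a`. -/
def halfTwists (a : ℤ) : Tangle 2 2 :=
  ⟨List.replicate a.natAbs ⟨.cross (decide (0 < a)), 0⟩, by
    induction a.natAbs with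
    | zero => rfl
    | succ k ih => exact ih⟩

/-- The inverse of a tangle (slope `x` becomes `1 / x`): a quarter turn composed with the mirror
image. -/
def invert (T : Tangle 2 2) : Tangle 2 2 := mirror (rotate T)

/-- The rational tangle with continued fraction `[a₁, …, aₙ]`, of slope
`1 / (aₙ + 1 / (aₙ₋₁ + ⋯ + 1 / a₁))`; this is the tangle `a₁ a₂ … aₙ` in Conway's notation. -/
def rationalTangle (a : List ℤ) : Tangle 2 2 :=
  a.foldl (fun T k => invert (glue T (halfTwists k))) idTangle

/-- Numerator and denominator, up to a common sign, of the continued fraction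
`1 / (aₙ + 1 / (aₙ₋₁ + ⋯ + 1 / a₁))`.  No division occurs: `(1, 0)` stands for the slope `∞`. -/
def slope (a : List ℤ) : ℤ × ℤ :=
  a.foldl (fun x k => (x.2, k * x.2 + x.1)) (0, 1)

/-- `T` is a diagram of the rational tangle of slope `β / α`, where `α > 1` and `β` are coprime:
it is given by a continued fraction of `β / α`. -/
def IsRationalTangle (T : Tangle 2 2) (α β : ℤ) : Prop :=
  1 < α ∧ IsCoprime α β ∧
    ∃ a : List ℤ, T = rationalTangle a ∧ (slope a = (β, α) ∨ slope a = (-β, -α))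

/-! ### Montesinos links -/

/-- The sum of a list of tangles. -/
def tangleSum (Ts : List (Tangle 2 2)) : Tangle 2 2 := Ts.foldr glue idTangle

/-- The closure of a tangle: the top ends are joined to the bottom ends by two parallel strands
running around on the right. -/
def closure (T : Tangle 2 2) : LinkDiagram :=
  ⟨[⟨.cup, 0⟩, ⟨.cup, 1⟩] ++ T.1 ++ [⟨.cap, 1⟩, ⟨.cap, 0⟩], by
    have h := strands_shift 0 2 T.1 2 2 T.2
    have h1 : shift 0 T.1 = T.1 := by simp [shift]
    rw [h1] at h
    rw [strands_append, strands_append]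
    have h0 : strands [⟨.cup, 0⟩, ⟨.cup, 1⟩] 0 = some 4 := rfl
    rw [h0]
    simp only [Option.bind_some]
    rw [h]
    rfl⟩

/-- The Montesinos diagram with the given tangles arranged cyclically, followed by `e` half twists.
A half twist counted by `e` is opposite to the tangle of slope `1`, so that
`e - ∑ βᵢ / αᵢ` is the invariant rational number of the link. -/
def montesinosDiagram (e : ℤ) (Ts : List (Tangle 2 2)) : LinkDiagram :=
  closure (glue (tangleSum Ts) (halfTwists (-e)))

/-- The link with diagram `L` is the Montesinos link `M(e; (α₁, β₁), …, (αᵣ, βᵣ))`. -/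
def IsMontesinosLink (L : LinkDiagram) (e : ℤ) (p : List (ℤ × ℤ)) : Prop :=
  ∃ Ts : List (Tangle 2 2), List.Forall₂ (fun T x => IsRationalTangle T x.1 x.2) Ts p ∧
    Isotopic L (montesinosDiagram e Ts)

/-- The description `M(e; (α₁, β₁), …, (αᵣ, βᵣ))` is in standard form: `0 < βᵢ / αᵢ < 1`. -/
def IsStandardForm (p : List (ℤ × ℤ)) : Prop :=
  ∀ x ∈ p, 0 < (x.2 : ℚ) / (x.1 : ℚ) ∧ (x.2 : ℚ) / (x.1 : ℚ) < 1

/-- The condition `e = 1` and `αᵢ / (αᵢ - βᵢ) > min {αⱼ / βⱼ | j ≠ i}` for some `i`. -/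
def ThirdCondition (e : ℤ) (p : List (ℤ × ℤ)) : Prop :=
  e = 1 ∧ ∃ i : Fin p.length, ∃ μ : ℚ,
    IsLeast {t : ℚ | ∃ j : Fin p.length, j ≠ i ∧ t = ((p.get j).1 : ℚ) / ((p.get j).2 : ℚ)} μ ∧
    μ < ((p.get i).1 : ℚ) / (((p.get i).1 : ℚ) - ((p.get i).2 : ℚ))

/-- The link with diagram `L` falls into the third case through the description
`M(1; (α₁, β₁), …, (αᵣ, βᵣ))`. -/
def FallsIntoThirdCase (L : LinkDiagram) (p : List (ℤ × ℤ)) : Prop :=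
  IsMontesinosLink L 1 p ∧ IsStandardForm p ∧ ThirdCondition 1 p

/-- The link `L(A, R, C)` built from three tangles, without additional half twists. -/
def threeTangleLink (A R C : Tangle 2 2) : LinkDiagram := montesinosDiagram 0 [A, R, C]

end Montesinos

/-! The links are already Montesinos links, with `e = 0` and a third tangle of slope `-c / y`, where
`0 < c / y < 1`. Writing this tangle as a tangle of slope `1 - c / y` followed by one half twist of
slope `-1`, which is exactly what `e = 1` counts, gives the required standard form. The third
condition for `i = 3` reads `y / (y - (y - c)) = y / c > min`, so it suffices that `x / a < y / c`,
where `a / x` is the slope of the first tangle; in each of the four families this is an integer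
inequality.

The topological work is to realise `slope + 1` by a continued fraction. Appending `1, 0` to the
fraction inverts twice, and the two mirror images cancel, so the result is the tangle with one added
crossing, turned by a half turn. Hence rational tangles must be shown invariant under a half turn in
the plane. This does not pass by itself through the recursive construction: the half turn carries
the newest crossing from the top to the bottom, so crossings must commute with the tangle (a flype),
and this must hold for the rotated tangle as well. `IsSymmetric` strengthens the induction
accordingly, adding that a strand can be swept across the tangle, which is what proves the rotated
flype after a crossing is added. All four properties survive mirroring, rotation and adding a
crossing. -/

namespace Montesinos

/-! ### Isotopy of slice sequences -/

/-- The slice sequences `D` and `E` are isotopic tangle diagrams with `m` end points at the bottom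
and `n` end points at the top. -/
def Iso (m n : ℕ) (D E : Diagram) : Prop :=
  ∃ (hD : strands D m = some n) (hE : strands E m = some n),
    Isotopic (⟨D, hD⟩ : Tangle m n) ⟨E, hE⟩

/-- A local minimum with `i` strands to the left. -/
abbrev cup (i : ℕ) : Slice := ⟨.cup, i⟩

/-- A local maximum with `i` strands to the left. -/
abbrev cap (i : ℕ) : Slice := ⟨.cap, i⟩

/-- A crossing with `i` strands to the left. -/
abbrev cross (s : Bool) (i : ℕ) : Slice := ⟨.cross s, i⟩

/-- All crossings of a slice sequence changed. -/
def mirrorList (D : Diagram) : Diagram := D.map fun x => ⟨x.piece.mirror, x.pos⟩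

/-! ### Bookkeeping for shifts, mirror images and strand counts. -/

@[simp] theorem shift_nil (k : ℕ) : shift k [] = [] := rfl

@[simp] theorem shift_cons (k : ℕ) (x : Slice) (D : Diagram) :
    shift k (x :: D) = ⟨x.piece, x.pos + k⟩ :: shift k D := rfl

@[simp] theorem shift_append (k : ℕ) (D E : Diagram) :
    shift k (D ++ E) = shift k D ++ shift k E := by simp [shift]

@[simp] theorem shift_shift (k l : ℕ) (D : Diagram) :
    shift k (shift l D) = shift (l + k) D := by
  simp [shift, Function.comp_def, Nat.add_assoc]

@[simp] theorem shift_zero (D : Diagram) : shift 0 D = D := by simp [shift]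

@[simp] theorem mirrorList_nil : mirrorList [] = [] := rfl

@[simp] theorem mirrorList_cons (x : Slice) (D : Diagram) :
    mirrorList (x :: D) = ⟨x.piece.mirror, x.pos⟩ :: mirrorList D := rfl

@[simp] theorem mirrorList_append (D E : Diagram) :
    mirrorList (D ++ E) = mirrorList D ++ mirrorList E := by simp [mirrorList]

@[simp] theorem mirrorList_shift (k : ℕ) (D : Diagram) :
    mirrorList (shift k D) = shift k (mirrorList D) := by
  simp [mirrorList, shift, Function.comp_def]

@[simp] theorem mirrorList_mirrorList (D : Diagram) : mirrorList (mirrorList D) = D := by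
  have h : ∀ x : Slice, (⟨x.piece.mirror.mirror, x.pos⟩ : Slice) = x := by
    rintro ⟨p, i⟩
    cases p <;> simp [Piece.mirror]
  simp [mirrorList, Function.comp_def, h]

theorem mirror_val {m n : ℕ} (T : Tangle m n) : (mirror T).1 = mirrorList T.1 := rfl

theorem rotate_val (T : Tangle 2 2) : (rotate T).1 = cup 0 :: (shift 1 T.1 ++ [cap 2]) := rfl

theorem glue_val {l m n : ℕ} (S : Tangle l m) (T : Tangle m n) : (glue S T).1 = S.1 ++ T.1 := rfl

theorem strands_shift_append (T : Tangle 2 2) (k m : ℕ) (D : Diagram) (h : k + 2 ≤ m) :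
    strands (shift k T.1 ++ D) m = strands D m := by
  have := strands_shift k (m - (k + 2)) T.1 2 2 T.2
  rw [show 2 + k + (m - (k + 2)) = m by omega] at this
  rw [strands_append, this]
  rfl

theorem strands_val_append (T : Tangle 2 2) (m : ℕ) (D : Diagram) (h : 2 ≤ m) :
    strands (T.1 ++ D) m = strands D m := by
  simpa using strands_shift_append T 0 m D (by omega)

theorem strands_shift_val (T : Tangle 2 2) (k m : ℕ) (h : k + 2 ≤ m) :
    strands (shift k T.1) m = some m := by
  simpa [strands] using strands_shift_append T k m [] h

theorem strands_val (T : Tangle 2 2) (m : ℕ) (h : 2 ≤ m) : strands T.1 m = some m := by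
  simpa using strands_shift_val T 0 m (by omega)

/-! ### Calculus of isotopies: single moves, contexts, mirroring and shifting. -/

namespace Iso

variable {m n : ℕ} {D E F : Diagram}

theorem refl (h : strands D m = some n) : Iso m n D D := ⟨h, h, .refl _⟩

theorem symm : Iso m n D E → Iso m n E D := fun ⟨h, h', i⟩ => ⟨h', h, .symm _ _ i⟩

theorem trans : Iso m n D E → Iso m n E F → Iso m n D F :=
  fun ⟨h, _, i⟩ ⟨_, h', j⟩ => ⟨h, h', .trans _ _ _ i j⟩

instance : Trans (Iso m n) (Iso m n) (Iso m n) := ⟨trans⟩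

theorem isotopic {S T : Tangle m n} : Iso m n S.1 T.1 → Isotopic S T := fun ⟨_, _, h⟩ => h

/-- An elementary move inside a diagram. -/
theorem step (below above : Diagram) {x y : Diagram} (h : Move x y)
    -- The defaults discharge list identities and strand counts for explicit diagrams; they are
    -- overridden where a rotated or glued tangle has to be unfolded.
    (hD : D = below ++ x ++ above := by simp [Piece.ins, Piece.outs])
    (hE : E = below ++ y ++ above := by simp [Piece.ins, Piece.outs])
    (sD : strands D m = some n := by
      simp [strands, Piece.ins, Piece.outs, strands_shift_append, strands_val_append,
        strands_shift_val, strands_val])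
    (sE : strands E m = some n := by
      simp [strands, Piece.ins, Piece.outs, strands_shift_append, strands_val_append,
        strands_shift_val, strands_val]) : Iso m n D E :=
  ⟨sD, sE, .rel _ _ ⟨below, x, y, above, h, hD, hE⟩⟩

/-- An operation on slice sequences that respects elementary moves respects isotopy. -/
theorem lift {m' n' : ℕ} (f : Diagram → Diagram)
    (hf : ∀ D, strands D m = some n → strands (f D) m' = some n')
    (h : ∀ below x y above, Move x y → strands (below ++ x ++ above) m = some n →
      strands (below ++ y ++ above) m = some n →
      Iso m' n' (f (below ++ x ++ above)) (f (below ++ y ++ above))) :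
    Iso m n D E → Iso m' n' (f D) (f E) := by
  rintro ⟨hD, hE, i⟩
  -- The induction on `EqvGen` needs variable end points, not the particular pairs built from `D`
  -- and `E`.
  suffices key : ∀ S T : Tangle m n, Isotopic S T → Iso m' n' (f S.1) (f T.1) from key _ _ i
  intro S T i
  induction i with
  | rel S T hs =>
    obtain ⟨b, x, y, a, hm, e, e'⟩ := hs
    have hS := S.2
    have hT := T.2
    rw [e] at hS ⊢
    rw [e'] at hT ⊢
    exact h b x y a hm hS hT
  | refl S => exact refl (hf _ S.2)
  | symm _ _ _ ih => exact ih.symm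
  | trans _ _ _ _ _ ih ih' => exact ih.trans ih'

/-- An isotopy inside a diagram. -/
theorem ctx {a b : ℕ} (below above : Diagram) {x y : Diagram} (h : Iso a b x y)
    (hD : D = below ++ x ++ above := by simp [Piece.ins, Piece.outs])
    (hE : E = below ++ y ++ above := by simp [Piece.ins, Piece.outs])
    (hb : strands below m = some a := by
      simp [strands, Piece.ins, Piece.outs, strands_shift_append, strands_val_append,
        strands_shift_val, strands_val])
    (ha : strands above b = some n := by
      simp [strands, Piece.ins, Piece.outs, strands_shift_append, strands_val_append,
        strands_shift_val, strands_val]) : Iso m n D E := by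
  subst hD hE
  have key : ∀ D, strands D a = some b → strands (below ++ D ++ above) m = some n := by
    intro D h
    simp [strands_append, hb, h, ha]
  refine lift (fun D => below ++ D ++ above) key ?_ h
  intro b' x y a' hm h1 h2
  exact step (below ++ b') (a' ++ above) hm (by simp) (by simp) (key _ h1) (key _ h2)

/-- Every move comes with both signs, so changing all crossings turns a move into a move of the same
kind. -/
theorem map_mirror : Iso m n D E → Iso m n (mirrorList D) (mirrorList E) := by
  have key : ∀ D, strands D m = some n → strands (mirrorList D) m = some n := by
    intro D h
    rw [← h]
    exact strands_mirror D m
  refine lift mirrorList key ?_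
  intro b x y a hm h1 h2
  have hm' : Move (mirrorList x) (mirrorList y) := by
    cases hm with
    | straighten_right i => exact .straighten_right i
    | straighten_left i => exact .straighten_left i
    | exchange p q i k =>
      have := Move.exchange p.mirror q.mirror i k
      have h1 : p.mirror.outs = p.outs := by cases p <;> rfl
      have h2 : p.mirror.ins = p.ins := by cases p <;> rfl
      rw [h1, h2] at this
      exact this
    | slide_cup s i => exact .slide_cup (!s) i
    | slide_cap s i => exact .slide_cap (!s) i
    | reidemeister_one_cup s i => exact .reidemeister_one_cup (!s) i
    | reidemeister_one_cap s i => exact .reidemeister_one_cap (!s) i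
    | reidemeister_two s i => exact .reidemeister_two (!s) i
    | reidemeister_three s i => exact .reidemeister_three (!s) i
  exact step (mirrorList b) (mirrorList a) hm' (by simp) (by simp) (key _ h1) (key _ h2)

/-- Vertical strands added on both sides. -/
theorem map_shift (k r : ℕ) :
    Iso m n D E → Iso (m + k + r) (n + k + r) (shift k D) (shift k E) := by
  refine lift (shift k) (fun D h => strands_shift k r D m n h) ?_
  intro b x y a hm h1 h2
  have hm' : Move (shift k x) (shift k y) := by
    cases hm with
    | straighten_right i =>
      simpa [Nat.add_right_comm] using Move.straighten_right (i + k)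
    | straighten_left i =>
      simpa [Nat.add_right_comm] using Move.straighten_left (i + k)
    | exchange p q i j =>
      simpa [Nat.add_right_comm] using Move.exchange p q (i + k) j
    | slide_cup s i => simpa [Nat.add_right_comm] using Move.slide_cup s (i + k)
    | slide_cap s i => simpa [Nat.add_right_comm] using Move.slide_cap s (i + k)
    | reidemeister_one_cup s i => exact .reidemeister_one_cup s (i + k)
    | reidemeister_one_cap s i => exact .reidemeister_one_cap s (i + k)
    | reidemeister_two s i => exact .reidemeister_two s (i + k)
    | reidemeister_three s i =>
      simpa [Nat.add_right_comm] using Move.reidemeister_three s (i + k)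
  exact step (shift k b) (shift k a) hm' (by simp) (by simp)
    (strands_shift k r _ m n h1) (strands_shift k r _ m n h2)

end Iso

/-! ### Moving a piece vertically past a whole tangle. -/

theorem strands_add (r : ℕ) {D : Diagram} {m n : ℕ} (h : strands D m = some n) :
    strands D (m + r) = some (n + r) := by
  simpa using strands_shift 0 r D m n h

/-- Induction on the slices of `D`, with one `exchange` move each. The piece `q` keeps `j` strands
between itself and `D`, so its position is `b + j` above `D` and `a + j` below. -/
theorem iso_exchange_right_aux (q : Piece) (j r : ℕ) (D : Diagram) :
    ∀ a b : ℕ, strands D a = some b →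
      Iso (a + (j + q.ins + r)) (b + (j + q.outs + r)) (D ++ [⟨q, b + j⟩]) (⟨q, a + j⟩ :: D) := by
  induction D with
  | nil =>
    intro a b h
    simp only [strands, Option.some.injEq] at h
    subst h
    refine Iso.refl ?_
    simp only [List.nil_append, strands]
    rw [if_pos (by omega)]
    congr 1
    omega
  | cons x D ih =>
    intro a b h
    obtain ⟨p, i⟩ := x
    simp only [strands] at h
    split at h
    · rename_i hx
      have e1 := ih _ _ h
      have s1 : strands (⟨q, a + j⟩ :: ⟨p, i⟩ :: D) (a + (j + q.ins + r)) =
          some (b + (j + q.outs + r)) := by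
        simp only [strands]
        rw [if_pos (by omega), if_pos (by omega)]
        have := strands_add (j + q.outs + r) h
        rw [← this]
        congr 1
        omega
      have s2 : strands (⟨p, i⟩ :: ⟨q, a - p.ins + p.outs + j⟩ :: D) (a + (j + q.ins + r)) =
          some (b + (j + q.outs + r)) := by
        simp only [strands]
        rw [if_pos (by omega), if_pos (by omega)]
        have := strands_add (j + q.outs + r) h
        rw [← this]
        congr 1
        omega
      refine Iso.trans (Iso.ctx [⟨p, i⟩] [] e1 (by simp) rfl ?_ rfl) ?_
      · simp only [strands]
        rw [if_pos (by omega)]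
        congr 1
        omega
      -- Between `p` and `q` lie the strands of `D` to the right of `p`, and then the gap `j`.
      · refine Iso.step [] D (Move.exchange p q i (a - i - p.ins + j)) ?_ ?_ ?_ s1
        · simp only [List.append_nil, List.nil_append, List.cons_append]
          congr 3
          omega
        · simp only [List.nil_append, List.cons_append]
          congr 2
          omega
        · simpa using s2
    · simp at h

theorem iso_exchange_left_aux (p : Piece) (j k r : ℕ) (D : Diagram) :
    ∀ a b : ℕ, strands D a = some b →
      Iso (a + (j + p.ins + k + r)) (b + (j + p.outs + k + r))
        (⟨p, j⟩ :: shift (j + p.outs + k) D) (shift (j + p.ins + k) D ++ [⟨p, j⟩]) := by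
  induction D with
  | nil =>
    intro a b h
    simp only [strands, Option.some.injEq] at h
    subst h
    refine Iso.refl ?_
    simp only [shift_nil, strands]
    rw [if_pos (by omega)]
    congr 1
    omega
  | cons x D ih =>
    intro a b h
    obtain ⟨q, i⟩ := x
    simp only [strands] at h
    split at h
    · rename_i hx
      have e1 := ih _ _ h
      obtain ⟨sa, sb, -⟩ := e1
      have s0 : strands (⟨q, i + (j + p.ins + k)⟩ :: ⟨p, j⟩ :: shift (j + p.outs + k) D)
          (a + (j + p.ins + k + r)) = some (b + (j + p.outs + k + r)) := by
        rw [strands, if_pos (by simp only; omega), ← sa]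
        congr 1
        simp only
        omega
      have s1 : strands (⟨p, j⟩ :: ⟨q, i + (j + p.outs + k)⟩ :: shift (j + p.outs + k) D)
          (a + (j + p.ins + k + r)) = some (b + (j + p.outs + k + r)) := by
        simp only [strands] at s0 ⊢
        rw [if_pos (by omega), if_pos (by omega)] at s0 ⊢
        rw [← s0]
        congr 1
        omega
      refine Iso.trans (Iso.step [] (shift (j + p.outs + k) D) (Move.exchange p q j (k + i))
        ?_ ?_ ?_ s0) (Iso.ctx [⟨q, i + (j + p.ins + k)⟩] [] (ih _ _ h) (by simp) (by simp) ?_ rfl)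
      · simp; omega
      · simp; omega
      · simpa using s1
      · simp only [strands]
        rw [if_pos (by omega)]
        congr 1
        omega
    · simp at h

/-- A piece to the right of a tangle moves past it. -/
theorem iso_exchange_right (T : Tangle 2 2) (q : Piece) (k j m : ℕ)
    (hj : k + 2 ≤ j := by norm_num) (hm : j + q.ins ≤ m := by norm_num [Piece.ins]) :
    Iso m (m - q.ins + q.outs) (shift k T.1 ++ [⟨q, j⟩]) (⟨q, j⟩ :: shift k T.1) := by
  have h := (iso_exchange_right_aux q (j - (k + 2)) (m - j - q.ins) T.1 2 2 T.2).map_shift k 0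
  have e1 : 2 + (j - (k + 2)) + k = j := by omega
  have e2 : 2 + (j - (k + 2) + q.ins + (m - j - q.ins)) + k + 0 = m := by omega
  have e3 : 2 + (j - (k + 2) + q.outs + (m - j - q.ins)) + k + 0 = m - q.ins + q.outs := by omega
  simpa only [shift_append, shift_cons, shift_nil, e1, e2, e3] using h

/-- A piece to the left of a tangle moves past it. -/
theorem iso_exchange_left (T : Tangle 2 2) (p : Piece) (k j m : ℕ)
    (hj : j ≤ k := by norm_num) (hm : k + p.ins + 2 ≤ m := by norm_num [Piece.ins]) :
    Iso m (m - p.ins + p.outs) (⟨p, j⟩ :: shift (k + p.outs) T.1)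
      (shift (k + p.ins) T.1 ++ [⟨p, j⟩]) := by
  have h := iso_exchange_left_aux p j (k - j) (m - (k + p.ins + 2)) T.1 2 2 T.2
  have e1 : j + p.outs + (k - j) = k + p.outs := by omega
  have e2 : j + p.ins + (k - j) = k + p.ins := by omega
  have e3 : 2 + (k + p.ins + (m - (k + p.ins + 2))) = m := by omega
  have e4 : 2 + (k + p.outs + (m - (k + p.ins + 2))) = m - p.ins + p.outs := by omega
  rwa [e1, e2, e3, e4] at h

/-! ### Symmetries of rational tangles -/

/-- The third Reidemeister move with crossings of arbitrary sign in the lower strands. -/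
theorem iso_reidemeister_three (r s : Bool) (i m : ℕ) (h : i + 3 ≤ m := by norm_num) :
    Iso m m [cross r (i + 1), cross s i, cross s (i + 1)]
      [cross s i, cross s (i + 1), cross r i] := by
  have key : Iso 3 3 [cross r 1, cross s 0, cross s 1] [cross s 0, cross s 1, cross r 0] := by
    -- For opposite signs, a cancelling pair is created above, the equal-sign move is applied, and a
    -- pair cancels below.
    obtain rfl | rfl : r = s ∨ r = !s := by cases r <;> cases s <;> simp
    · exact (Iso.step [] [] (.reidemeister_three r 0)).symm
    · calc
        Iso 3 3 [cross (!s) 1, cross s 0, cross s 1]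
            [cross (!s) 1, cross s 0, cross s 1, cross s 0, cross (!s) 0] :=
          (Iso.step [cross (!s) 1, cross s 0, cross s 1] [] (.reidemeister_two s 0)).symm
        Iso 3 3 _ [cross (!s) 1, cross s 1, cross s 0, cross s 1, cross (!s) 0] :=
          Iso.step [cross (!s) 1] [cross (!s) 0] (.reidemeister_three s 0)
        Iso 3 3 _ [cross s 0, cross s 1, cross (!s) 0] :=
          Iso.step [] [cross s 0, cross s 1, cross (!s) 0] (.reidemeister_two (!s) 1)
  have := key.map_shift i (m - i - 3)
  rw [show 3 + i + (m - i - 3) = m by omega] at this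
  simpa [Nat.add_comm] using this

/-- The tangle consisting of one crossing. -/
def crossing (s : Bool) : Tangle 2 2 := ⟨[cross s 0], rfl⟩

/-- A strand passing in front of (or behind) the tangle can be moved from above to below. -/
def Slides (T : Tangle 2 2) : Prop :=
  ∀ s, Iso 3 3 (shift 1 T.1 ++ [cross s 0, cross s 1]) (cross s 0 :: cross s 1 :: T.1)

/-- Crossings at the top of the tangle can be moved to the bottom. -/
def Commutes (T : Tangle 2 2) : Prop := ∀ s, Iso 2 2 (T.1 ++ [cross s 0]) (cross s 0 :: T.1)

/-- The symmetries that all rational tangles have. -/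
structure IsSymmetric (T : Tangle 2 2) : Prop where
  slides : Slides T
  commutes : Commutes T
  commutes_rotate : Commutes (rotate T)
  rotate_rotate : Iso 2 2 (rotate (rotate T)).1 T.1

theorem iso_rotate {S T : Tangle 2 2} (h : Iso 2 2 S.1 T.1) :
    Iso 2 2 (rotate S).1 (rotate T).1 :=
  Iso.ctx [cup 0] [cap 2] (h.map_shift 1 1) (by simp [rotate_val]) (by simp [rotate_val])

theorem Commutes.congr {S T : Tangle 2 2} (hT : Commutes T) (h : Iso 2 2 S.1 T.1) :
    Commutes S := fun s => calc
  Iso 2 2 (S.1 ++ [cross s 0]) (T.1 ++ [cross s 0]) := Iso.ctx [] [cross s 0] h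
  Iso 2 2 _ (cross s 0 :: T.1) := hT s
  Iso 2 2 _ (cross s 0 :: S.1) := Iso.ctx [cross s 0] [] h.symm

/-- Each strand is an S-curve; exchanging the inner minimum with the outer maximum lets both be
straightened. -/
theorem iso_double_turn :
    Iso 2 2 [cup 0, cup 1, cap 3, cap 2] [] := calc
  Iso 2 2 [cup 0, cup 1, cap 3, cap 2] [cup 0, cap 1, cup 1, cap 2] :=
    Iso.step [cup 0] [cap 2] (.exchange .cup .cap 1 0)
  Iso 2 2 _ [cup 1, cap 2] := Iso.step [] [cup 1, cap 2] (.straighten_right 0)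
  Iso 2 2 _ [] := Iso.step [] [] (.straighten_right 1)

/-- The only property with content beyond `iso_double_turn` is `commutes_rotate`: the rotated tangle
is a maximum below a minimum, and a crossing at either is a kink. -/
theorem isSymmetric_idTangle : IsSymmetric idTangle where
  slides s := Iso.refl rfl
  commutes s := Iso.refl rfl
  commutes_rotate s := calc
    Iso 2 2 [cup 0, cap 2, cross s 0] [cap 0, cup 0, cross s 0] :=
      Iso.step [] [cross s 0] (.exchange .cup .cap 0 0)
    Iso 2 2 _ [cap 0, cup 0] := Iso.step [cap 0] [] (.reidemeister_one_cup s 0)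
    Iso 2 2 _ [cross s 0, cap 0, cup 0] := (Iso.step [] [cup 0] (.reidemeister_one_cap s 0)).symm
    Iso 2 2 _ [cross s 0, cup 0, cap 2] :=
      (Iso.step [cross s 0] [] (.exchange .cup .cap 0 0)).symm
  rotate_rotate := iso_double_turn

/-- A cancelling pair at the upper bend makes the strand cross all four vertical strands. It is then
swept below `T`, and its two crossings with the lower bend cancel. -/
theorem Slides.rotate {T : Tangle 2 2} (h : Slides T) : Slides (rotate T) := fun s => calc
  Iso 3 3 (shift 1 (Montesinos.rotate T).1 ++ [cross s 0, cross s 1])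
      (cup 1 :: (shift 2 T.1 ++ [cross s 0, cap 3, cross s 1])) :=
    (Iso.step (cup 1 :: shift 2 T.1) [cross s 1] (.exchange (.cross s) .cap 0 1)
      (hE := by simp [rotate_val, Piece.ins])
      (sE := by simp [rotate_val, strands, Piece.ins, Piece.outs, strands_shift_append])).symm
  Iso 3 3 _ (cup 1 :: (shift 2 T.1 ++ [cross s 0, cross s 1, cap 3])) :=
    (Iso.step (cup 1 :: (shift 2 T.1 ++ [cross s 0])) [] (.exchange (.cross s) .cap 1 0)).symm
  Iso 3 3 _ (cup 1 :: (shift 2 T.1 ++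
      [cross s 0, cross s 1, cross s 2, cross (!s) 2, cap 3])) :=
    (Iso.step (cup 1 :: (shift 2 T.1 ++ [cross s 0, cross s 1])) [cap 3]
      (.reidemeister_two s 2)).symm
  Iso 3 3 _ (cup 1 :: (shift 2 T.1 ++ [cross s 0, cross s 1, cross s 2, cross s 3, cap 2])) :=
    Iso.step (cup 1 :: (shift 2 T.1 ++ [cross s 0, cross s 1, cross s 2])) []
      (.slide_cap (!s) 2)
  Iso 3 3 _ (cup 1 :: cross s 0 ::
      (shift 2 T.1 ++ [cross s 1, cross s 2, cross s 3, cap 2])) :=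
    Iso.ctx [cup 1] [cross s 1, cross s 2, cross s 3, cap 2]
      (iso_exchange_left T (.cross s) 0 0 5).symm
  Iso 3 3 _ (cup 1 :: cross s 0 :: cross s 1 :: cross s 2 ::
      (shift 1 T.1 ++ [cross s 3, cap 2])) :=
    Iso.ctx [cup 1, cross s 0] [cross s 3, cap 2] ((h s).map_shift 1 1)
  Iso 3 3 _ (cup 0 :: cross (!s) 1 :: cross s 1 :: cross s 2 ::
      (shift 1 T.1 ++ [cross s 3, cap 2])) :=
    (Iso.step [] (cross s 1 :: cross s 2 :: (shift 1 T.1 ++ [cross s 3, cap 2]))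
      (.slide_cup (!s) 0)).symm
  Iso 3 3 _ (cup 0 :: cross s 2 :: (shift 1 T.1 ++ [cross s 3, cap 2])) :=
    Iso.step [cup 0] (cross s 2 :: (shift 1 T.1 ++ [cross s 3, cap 2]))
      (.reidemeister_two (!s) 1)
  Iso 3 3 _ (cup 0 :: cross s 2 :: cross s 3 :: (shift 1 T.1 ++ [cap 2])) :=
    Iso.ctx [cup 0, cross s 2] [cap 2] (iso_exchange_right T (.cross s) 1 3 5)
  Iso 3 3 _ (cross s 0 :: cup 0 :: cross s 3 :: (shift 1 T.1 ++ [cap 2])) :=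
    Iso.step [] (cross s 3 :: (shift 1 T.1 ++ [cap 2])) (.exchange .cup (.cross s) 0 0)
  Iso 3 3 _ (cross s 0 :: cross s 1 :: (Montesinos.rotate T).1) :=
    Iso.step [cross s 0] (shift 1 T.1 ++ [cap 2]) (.exchange .cup (.cross s) 0 1)
      (hE := by simp [rotate_val, Piece.ins])
      (sE := by simp [rotate_val, strands, Piece.ins, Piece.outs, strands_shift_append])

theorem Slides.glue_crossing {T : Tangle 2 2} (h : Slides T) (r : Bool) :
    Slides (glue T (crossing r)) := fun s => calc
  Iso 3 3 (shift 1 (glue T (crossing r)).1 ++ [cross s 0, cross s 1])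
      (shift 1 T.1 ++ [cross s 0, cross s 1, cross r 0]) :=
    Iso.ctx (shift 1 T.1) [] (iso_reidemeister_three r s 0 3) (by simp [glue_val, crossing])
  Iso 3 3 _ (cross s 0 :: cross s 1 :: (glue T (crossing r)).1) :=
    Iso.ctx [] [cross r 0] (h s) (hE := by simp [glue_val, crossing])

/-! ### Tangles with all four ends turned upwards. -/

/-- A tangle is recovered from the one with both lower ends turned upwards. -/
theorem iso_unbend (T : Tangle 2 2) :
    Iso 2 2 T.1 (cup 0 :: cup 1 :: (T.1 ++ [cap 3, cap 2])) := calc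
  Iso 2 2 T.1 (cup 0 :: cup 1 :: cap 3 :: cap 2 :: T.1) := Iso.ctx [] T.1 iso_double_turn.symm
  Iso 2 2 _ (cup 0 :: cup 1 :: cap 3 :: (T.1 ++ [cap 2])) :=
    Iso.ctx [cup 0, cup 1, cap 3] []
      (by simpa [Piece.ins, Piece.outs] using (iso_exchange_right T .cap 0 2 4).symm)
  Iso 2 2 _ (cup 0 :: cup 1 :: (T.1 ++ [cap 3, cap 2])) :=
    Iso.ctx [cup 0, cup 1] [cap 2]
      (by simpa [Piece.ins, Piece.outs] using (iso_exchange_right T .cap 0 3 6).symm)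

/-- Turning the lower ends up is reversible. With all ends up, a tangle and its rotation have
comparable pictures, so flypes can be checked there. -/
theorem iso_of_bend {S T : Tangle 2 2}
    (h : Iso 0 4 (cup 0 :: cup 1 :: S.1) (cup 0 :: cup 1 :: T.1)) : Iso 2 2 S.1 T.1 := calc
  Iso 2 2 S.1 (cup 0 :: cup 1 :: (S.1 ++ [cap 3, cap 2])) := iso_unbend S
  Iso 2 2 _ (cup 0 :: cup 1 :: (T.1 ++ [cap 3, cap 2])) :=
    Iso.ctx [] [cap 3, cap 2] (h.map_shift 0 2)
  Iso 2 2 _ T.1 := (iso_unbend T).symm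

/-- Turning up the lower ends of the rotated tangle gives the tangle with all ends turned up. -/
theorem iso_bend_rotate (T : Tangle 2 2) :
    Iso 0 4 (cup 0 :: cup 1 :: (rotate T).1) (cup 0 :: cup 2 :: shift 1 T.1) := calc
  Iso 0 4 (cup 0 :: cup 1 :: (rotate T).1) (cup 0 :: cup 0 :: cup 3 :: (shift 1 T.1 ++ [cap 2])) :=
    (Iso.step [cup 0] (shift 1 T.1 ++ [cap 2]) (.exchange .cup .cup 0 1)
      (hE := by simp [rotate_val, Piece.ins])
      (sE := by simp [rotate_val, strands, Piece.ins, Piece.outs, strands_shift_append])).symm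
  Iso 0 4 _ (cup 0 :: cup 2 :: cup 3 :: (shift 1 T.1 ++ [cap 2])) :=
    (Iso.step [] (cup 3 :: (shift 1 T.1 ++ [cap 2])) (.exchange .cup .cup 0 0)).symm
  Iso 0 4 _ (cup 0 :: cup 2 :: (shift 1 T.1 ++ [cup 3, cap 2])) :=
    Iso.ctx [cup 0, cup 2] [cap 2] (iso_exchange_right T .cup 1 3 4).symm
  Iso 0 4 _ (cup 0 :: cup 2 :: shift 1 T.1) :=
    Iso.step (cup 0 :: cup 2 :: shift 1 T.1) [] (.straighten_left 2)

/-- The lower crossing travels around the minimum, up the right side of `T` and over the maximum.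
Its sign flips at each bend, hence is `s` again. -/
theorem iso_bend_cross_rotate (T : Tangle 2 2) (s : Bool) :
    Iso 0 4 (cup 0 :: cup 1 :: cross s 0 :: (rotate T).1)
      (cup 0 :: cup 2 :: (shift 1 T.1 ++ [cross s 2])) := calc
  Iso 0 4 (cup 0 :: cup 1 :: cross s 0 :: (rotate T).1)
      (cup 0 :: cup 0 :: cross (!s) 1 :: (rotate T).1) :=
    (Iso.step [cup 0] (rotate T).1 (.slide_cup (!s) 0)).symm
  Iso 0 4 _ (cup 0 :: cup 0 :: cup 0 :: cross (!s) 3 :: (shift 1 T.1 ++ [cap 2])) :=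
    (Iso.step [cup 0, cup 0] (shift 1 T.1 ++ [cap 2]) (.exchange .cup (.cross (!s)) 0 1)
      (hE := by simp [rotate_val, Piece.ins])
      (sE := by simp [rotate_val, strands, Piece.ins, Piece.outs, strands_shift_append])).symm
  Iso 0 4 _ (cup 0 :: cup 0 :: cup 0 :: (shift 1 T.1 ++ [cross (!s) 3, cap 2])) :=
    Iso.ctx [cup 0, cup 0, cup 0] [cap 2] (iso_exchange_right T (.cross (!s)) 1 3 6).symm
  Iso 0 4 _ (cup 0 :: cup 0 :: cup 0 :: (shift 1 T.1 ++ [cross s 2, cap 3])) :=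
    (Iso.step (cup 0 :: cup 0 :: cup 0 :: shift 1 T.1) [] (.slide_cap s 2)).symm
  Iso 0 4 _ (cup 0 :: cup 2 :: cup 0 :: (shift 1 T.1 ++ [cross s 2, cap 3])) :=
    (Iso.step [] (cup 0 :: (shift 1 T.1 ++ [cross s 2, cap 3])) (.exchange .cup .cup 0 0)).symm
  Iso 0 4 _ (cup 0 :: cup 0 :: cup 4 :: (shift 1 T.1 ++ [cross s 2, cap 3])) :=
    (Iso.step [cup 0] (shift 1 T.1 ++ [cross s 2, cap 3]) (.exchange .cup .cup 0 2)).symm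
  Iso 0 4 _ (cup 0 :: cup 2 :: cup 4 :: (shift 1 T.1 ++ [cross s 2, cap 3])) :=
    (Iso.step [] (cup 4 :: (shift 1 T.1 ++ [cross s 2, cap 3])) (.exchange .cup .cup 0 0)).symm
  Iso 0 4 _ (cup 0 :: cup 2 :: (shift 1 T.1 ++ [cup 4, cross s 2, cap 3])) :=
    Iso.ctx [cup 0, cup 2] [cross s 2, cap 3] (iso_exchange_right T .cup 1 4 4).symm
  Iso 0 4 _ (cup 0 :: cup 2 :: (shift 1 T.1 ++ [cross s 2, cup 4, cap 3])) :=
    (Iso.step (cup 0 :: cup 2 :: shift 1 T.1) [cap 3] (.exchange (.cross s) .cup 2 0)).symm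
  Iso 0 4 _ (cup 0 :: cup 2 :: (shift 1 T.1 ++ [cross s 2])) :=
    Iso.step (cup 0 :: cup 2 :: (shift 1 T.1 ++ [cross s 2])) [] (.straighten_left 3)

theorem iso_bend_rotate_cross (T : Tangle 2 2) (s : Bool) :
    Iso 0 4 (cup 0 :: cup 1 :: ((rotate T).1 ++ [cross s 0]))
      (cup 0 :: cup 2 :: (shift 1 T.1 ++ [cross s 0])) :=
  Iso.ctx [] [cross s 0] (iso_bend_rotate T)

/-- Crossings commute with the rotated tangle when they can be moved from the left to the right
of the tangle. -/
theorem commutes_rotate_iff (T : Tangle 2 2) :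
    Commutes (rotate T) ↔ ∀ s, Iso 0 4 (cup 0 :: cup 2 :: (shift 1 T.1 ++ [cross s 0]))
      (cup 0 :: cup 2 :: (shift 1 T.1 ++ [cross s 2])) := by
  refine forall_congr' fun s => ⟨fun h => ?_, fun h => ?_⟩
  · exact ((iso_bend_rotate_cross T s).symm.trans
      (Iso.ctx [cup 0, cup 1] [] (h.map_shift 0 2))).trans (iso_bend_cross_rotate T s)
  · exact iso_of_bend (S := glue (rotate T) (crossing s)) (T := glue (crossing s) (rotate T))
      (((iso_bend_rotate_cross T s).trans h).trans (iso_bend_cross_rotate T s).symm)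

theorem iso_cross_comm (r s : Bool) (i m : ℕ) (h : i + 2 ≤ m := by norm_num) :
    Iso m m [cross r i, cross s i] [cross s i, cross r i] := by
  have h2 : strands [cross r i, cross s i] m = some m := by
    simp [strands, Piece.ins, Piece.outs, h, Nat.sub_add_cancel (le_trans (Nat.le_add_left 2 i) h)]
  obtain rfl | rfl : r = s ∨ r = !s := by cases r <;> cases s <;> simp
  · exact Iso.refl h2
  · have h3 : strands [cross s i, cross (!s) i] m = some m := h2
    exact (Iso.step (E := []) [] [] (.reidemeister_two (!s) i) (by simp) rfl h2 rfl).trans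
      (Iso.step [] [] (.reidemeister_two s i) (by simp) rfl h3 rfl).symm

/-- A crossing with one upper end only is a full sweep followed by undoing the crossing with the
other end. -/
theorem Slides.iso_cross {T : Tangle 2 2} (h : Slides T) (r : Bool) :
    Iso 3 3 (shift 1 T.1 ++ [cross r 0]) (cross r 0 :: cross r 1 :: (T.1 ++ [cross (!r) 1])) := calc
  Iso 3 3 (shift 1 T.1 ++ [cross r 0]) (shift 1 T.1 ++ [cross r 0, cross r 1, cross (!r) 1]) :=
    (Iso.step (shift 1 T.1 ++ [cross r 0]) [] (.reidemeister_two r 1)).symm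
  Iso 3 3 _ (cross r 0 :: cross r 1 :: (T.1 ++ [cross (!r) 1])) :=
    Iso.ctx [] [cross (!r) 1] (h r)

/-- A crossing between the two lower ends of a tangle all of whose ends are turned up can be
brought to the top by moving these ends across the tangle. -/
theorem Slides.iso_lower_cross {T : Tangle 2 2} (h : Slides T) (r s : Bool) :
    Iso 0 4 (cup 0 :: cup 2 :: cross s 1 :: (shift 1 T.1 ++ [cross r 0, cross (!r) 2]))
      (cup 0 :: cup 2 :: (shift 1 T.1 ++ [cross r 0, cross (!r) 2, cross s 1])) := by
  -- Both sides are reduced to one diagram in which the left end strand has been swept across `T`.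
  -- Its crossing with the first minimum is a kink; the crossing `s` follows through the third
  -- Reidemeister move, around the minima on the lower side and down past `T` on the upper side.
  have lower : Iso 0 4
      (cup 0 :: cup 2 :: cross s 1 :: (shift 1 T.1 ++ [cross r 0, cross (!r) 2]))
      (cup 0 :: cup 1 :: cross (!r) 2 :: cross s 2 :: (T.1 ++ [cross (!r) 1, cross (!r) 2])) := calc
    Iso 0 4 (cup 0 :: cup 2 :: cross s 1 :: (shift 1 T.1 ++ [cross r 0, cross (!r) 2]))
        (cup 0 :: cup 2 :: cross s 1 :: cross r 0 :: cross r 1 ::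
          (T.1 ++ [cross (!r) 1, cross (!r) 2])) :=
      Iso.ctx [cup 0, cup 2, cross s 1] [cross (!r) 2] ((h.iso_cross r).map_shift 0 1)
    Iso 0 4 _ (cup 0 :: cup 2 :: cross r 0 :: cross r 1 :: cross s 0 ::
          (T.1 ++ [cross (!r) 1, cross (!r) 2])) :=
      Iso.ctx [cup 0, cup 2] (T.1 ++ [cross (!r) 1, cross (!r) 2])
        (iso_reidemeister_three s r 0 4)
    Iso 0 4 _ (cup 0 :: cross r 0 :: cup 2 :: cross r 1 :: cross s 0 ::
          (T.1 ++ [cross (!r) 1, cross (!r) 2])) :=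
      (Iso.step [cup 0] (cross r 1 :: cross s 0 :: (T.1 ++ [cross (!r) 1, cross (!r) 2]))
        (.exchange (.cross r) .cup 0 0)).symm
    Iso 0 4 _ (cup 0 :: cup 2 :: cross r 1 :: cross s 0 ::
          (T.1 ++ [cross (!r) 1, cross (!r) 2])) :=
      Iso.step [] (cup 2 :: cross r 1 :: cross s 0 :: (T.1 ++ [cross (!r) 1, cross (!r) 2]))
        (.reidemeister_one_cup r 0)
    Iso 0 4 _ (cup 0 :: cup 1 :: cross (!r) 2 :: cross s 0 ::
          (T.1 ++ [cross (!r) 1, cross (!r) 2])) :=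
      (Iso.step [cup 0] (cross s 0 :: (T.1 ++ [cross (!r) 1, cross (!r) 2]))
        (.slide_cup (!r) 1)).symm
    Iso 0 4 _ (cup 0 :: cup 1 :: cross s 0 :: cross (!r) 2 ::
          (T.1 ++ [cross (!r) 1, cross (!r) 2])) :=
      (Iso.step [cup 0, cup 1] (T.1 ++ [cross (!r) 1, cross (!r) 2])
        (.exchange (.cross s) (.cross (!r)) 0 0)).symm
    Iso 0 4 _ (cup 0 :: cup 0 :: cross (!s) 1 :: cross (!r) 2 ::
          (T.1 ++ [cross (!r) 1, cross (!r) 2])) :=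
      (Iso.step [cup 0] (cross (!r) 2 :: (T.1 ++ [cross (!r) 1, cross (!r) 2]))
        (.slide_cup (!s) 0)).symm
    Iso 0 4 _ (cup 0 :: cup 2 :: cross (!s) 1 :: cross (!r) 2 ::
          (T.1 ++ [cross (!r) 1, cross (!r) 2])) :=
      (Iso.step [] (cross (!s) 1 :: cross (!r) 2 :: (T.1 ++ [cross (!r) 1, cross (!r) 2]))
        (.exchange .cup .cup 0 0)).symm
    Iso 0 4 _ (cup 0 :: cup 1 :: cross s 2 :: cross (!r) 2 ::
          (T.1 ++ [cross (!r) 1, cross (!r) 2])) :=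
      (Iso.step [cup 0] (cross (!r) 2 :: (T.1 ++ [cross (!r) 1, cross (!r) 2]))
        (.slide_cup s 1)).symm
    Iso 0 4 _ (cup 0 :: cup 1 :: cross (!r) 2 :: cross s 2 ::
          (T.1 ++ [cross (!r) 1, cross (!r) 2])) :=
      Iso.ctx [cup 0, cup 1] (T.1 ++ [cross (!r) 1, cross (!r) 2]) (iso_cross_comm s (!r) 2 4)
  have upper : Iso 0 4
      (cup 0 :: cup 2 :: (shift 1 T.1 ++ [cross r 0, cross (!r) 2, cross s 1]))
      (cup 0 :: cup 1 :: cross (!r) 2 :: cross s 2 :: (T.1 ++ [cross (!r) 1, cross (!r) 2])) := calc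
    Iso 0 4 (cup 0 :: cup 2 :: (shift 1 T.1 ++ [cross r 0, cross (!r) 2, cross s 1]))
        (cup 0 :: cup 2 :: cross r 0 :: cross r 1 ::
          (T.1 ++ [cross (!r) 1, cross (!r) 2, cross s 1])) :=
      Iso.ctx [cup 0, cup 2] [cross (!r) 2, cross s 1] ((h.iso_cross r).map_shift 0 1)
    Iso 0 4 _ (cup 0 :: cross r 0 :: cup 2 :: cross r 1 ::
          (T.1 ++ [cross (!r) 1, cross (!r) 2, cross s 1])) :=
      (Iso.step [cup 0] (cross r 1 :: (T.1 ++ [cross (!r) 1, cross (!r) 2, cross s 1]))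
        (.exchange (.cross r) .cup 0 0)).symm
    Iso 0 4 _ (cup 0 :: cup 2 :: cross r 1 ::
          (T.1 ++ [cross (!r) 1, cross (!r) 2, cross s 1])) :=
      Iso.step [] (cup 2 :: cross r 1 :: (T.1 ++ [cross (!r) 1, cross (!r) 2, cross s 1]))
        (.reidemeister_one_cup r 0)
    Iso 0 4 _ (cup 0 :: cup 1 :: cross (!r) 2 ::
          (T.1 ++ [cross (!r) 1, cross (!r) 2, cross s 1])) :=
      (Iso.step [cup 0] (T.1 ++ [cross (!r) 1, cross (!r) 2, cross s 1])
        (.slide_cup (!r) 1)).symm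
    Iso 0 4 _ (cup 0 :: cup 1 :: cross (!r) 2 ::
          (T.1 ++ [cross s 2, cross (!r) 1, cross (!r) 2])) :=
      Iso.ctx (cup 0 :: cup 1 :: cross (!r) 2 :: T.1) []
        (iso_reidemeister_three s (!r) 1 4).symm
    Iso 0 4 _ (cup 0 :: cup 1 :: cross (!r) 2 :: cross s 2 ::
          (T.1 ++ [cross (!r) 1, cross (!r) 2])) :=
      Iso.ctx [cup 0, cup 1, cross (!r) 2] [cross (!r) 1, cross (!r) 2]
        (iso_exchange_right T (.cross s) 0 2 4)
  exact lower.trans upper.symm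

theorem strands_replicate_cross (s : Bool) (n : ℕ) :
    strands (List.replicate n (cross s 0)) 2 = some 2 := by
  induction n with
  | zero => rfl
  | succ n ih => exact ih

/-! ### Stability of the symmetries under the construction of rational tangles. -/

namespace IsSymmetric

variable {T : Tangle 2 2}

theorem mirror (h : IsSymmetric T) : IsSymmetric (mirror T) where
  slides s := by simpa [mirror_val, Piece.mirror] using (h.slides (!s)).map_mirror
  commutes s := by simpa [mirror_val, Piece.mirror] using (h.commutes (!s)).map_mirror
  commutes_rotate s := by
    simpa [mirror_val, rotate_val, Piece.mirror] using (h.commutes_rotate (!s)).map_mirror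
  rotate_rotate := by
    simpa [mirror_val, rotate_val, Piece.mirror] using h.rotate_rotate.map_mirror

theorem rotate (h : IsSymmetric T) : IsSymmetric (rotate T) where
  slides := h.slides.rotate
  commutes := h.commutes_rotate
  commutes_rotate := h.commutes.congr h.rotate_rotate
  rotate_rotate := iso_rotate h.rotate_rotate

/-- The new crossing is flyped below `T`. The combination of `r` on the left and `!r` on the right
lets it return to the top by `Slides.iso_lower_cross`; the flype of `T` then moves `r` to the right,
where it cancels `!r` and leaves the inserted `r`. -/
theorem commutes_rotate_glue_crossing (h : IsSymmetric T) (s : Bool) :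
    Commutes (Montesinos.rotate (glue T (crossing s))) := by
  have h2 := (commutes_rotate_iff T).1 h.commutes_rotate
  rw [commutes_rotate_iff]
  intro r
  calc
    Iso 0 4 (cup 0 :: cup 2 :: (shift 1 (glue T (crossing s)).1 ++ [cross r 0]))
        (cup 0 :: cup 2 :: cross s 1 :: (shift 1 T.1 ++ [cross r 0])) :=
      Iso.ctx [cup 0, cup 2] [cross r 0] ((h.commutes s).map_shift 1 1)
        (by simp [glue_val, crossing])
    Iso 0 4 _ (cup 0 :: cup 2 :: cross s 1 ::
        (shift 1 T.1 ++ [cross r 0, cross (!r) 2, cross r 2])) :=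
      (Iso.step (cup 0 :: cup 2 :: cross s 1 :: (shift 1 T.1 ++ [cross r 0])) []
        (.reidemeister_two (!r) 2)).symm
    Iso 0 4 _ (cup 0 :: cup 2 ::
        (shift 1 T.1 ++ [cross r 0, cross (!r) 2, cross s 1, cross r 2])) :=
      Iso.ctx [] [cross r 2] (h.slides.iso_lower_cross r s)
    Iso 0 4 _ (cup 0 :: cup 2 ::
        (shift 1 T.1 ++ [cross r 2, cross (!r) 2, cross s 1, cross r 2])) :=
      Iso.ctx [] [cross (!r) 2, cross s 1, cross r 2] (h2 r)
    Iso 0 4 _ (cup 0 :: cup 2 :: (shift 1 (glue T (crossing s)).1 ++ [cross r 2])) :=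
      Iso.step (cup 0 :: cup 2 :: shift 1 T.1) [cross s 1, cross r 2] (.reidemeister_two r 2)
        (hE := by simp [glue_val, crossing])
        (sE := by simp [glue_val, crossing, strands, Piece.ins, Piece.outs, strands_shift_append])

/-- The crossing slides through the maxima, down the right side and past the minima to the bottom;
after `T` is turned back, the flype returns it to the top. -/
theorem rotate_rotate_glue_crossing (h : IsSymmetric T) (s : Bool) :
    Iso 2 2 (Montesinos.rotate (Montesinos.rotate (glue T (crossing s)))).1
      (glue T (crossing s)).1 := calc
  Iso 2 2 (Montesinos.rotate (Montesinos.rotate (glue T (crossing s)))).1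
      (cup 0 :: cup 1 :: (shift 2 T.1 ++ [cross (!s) 3, cap 2, cap 2])) :=
    Iso.step (cup 0 :: cup 1 :: shift 2 T.1) [cap 2] (.slide_cap s 2)
      (by simp [rotate_val, glue_val, crossing])
      (sD := by simp [rotate_val, glue_val, crossing, strands, Piece.ins, Piece.outs,
        strands_shift_append])
  Iso 2 2 _ (cup 0 :: cup 1 :: (shift 2 T.1 ++ [cross (!s) 3, cap 4, cap 2])) :=
    Iso.step (cup 0 :: cup 1 :: (shift 2 T.1 ++ [cross (!s) 3])) [] (.exchange .cap .cap 2 0)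
  Iso 2 2 _ (cup 0 :: cup 1 :: (shift 2 T.1 ++ [cross s 4, cap 3, cap 2])) :=
    Iso.step (cup 0 :: cup 1 :: shift 2 T.1) [cap 2] (.slide_cap (!s) 3)
  Iso 2 2 _ (cup 0 :: cup 1 :: cross s 4 :: (shift 2 T.1 ++ [cap 3, cap 2])) :=
    Iso.ctx [cup 0, cup 1] [cap 3, cap 2] (iso_exchange_right T (.cross s) 2 4 6)
  Iso 2 2 _ (cup 0 :: cross s 2 :: cup 1 :: (shift 2 T.1 ++ [cap 3, cap 2])) :=
    Iso.step [cup 0] (shift 2 T.1 ++ [cap 3, cap 2]) (.exchange .cup (.cross s) 1 1)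
  Iso 2 2 _ (cross s 0 :: cup 0 :: cup 1 :: (shift 2 T.1 ++ [cap 3, cap 2])) :=
    Iso.step [] (cup 1 :: (shift 2 T.1 ++ [cap 3, cap 2])) (.exchange .cup (.cross s) 0 0)
  Iso 2 2 _ (cross s 0 :: T.1) :=
    Iso.ctx [cross s 0] [] h.rotate_rotate (by simp [rotate_val])
  Iso 2 2 _ (glue T (crossing s)).1 := (h.commutes s).symm

theorem glue_crossing (h : IsSymmetric T) (s : Bool) : IsSymmetric (glue T (crossing s)) where
  slides := h.slides.glue_crossing s
  commutes r := calc
    Iso 2 2 ((glue T (crossing s)).1 ++ [cross r 0]) (T.1 ++ [cross r 0, cross s 0]) :=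
      Iso.ctx T.1 [] (iso_cross_comm s r 0 2) (by simp [glue_val, crossing])
    Iso 2 2 _ (cross r 0 :: (glue T (crossing s)).1) :=
      Iso.ctx [] [cross s 0] (h.commutes r) (hE := by simp [glue_val, crossing])
  commutes_rotate := h.commutes_rotate_glue_crossing s
  rotate_rotate := h.rotate_rotate_glue_crossing s

theorem glue_halfTwists (h : IsSymmetric T) (k : ℤ) : IsSymmetric (glue T (halfTwists k)) := by
  have key : ∀ (s : Bool) (n : ℕ) (S : Tangle 2 2), S.1 = T.1 ++ List.replicate n (cross s 0) →
      IsSymmetric S := by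
    intro s n
    induction n with
    | zero =>
      intro S e
      rwa [Subtype.ext (a1 := S) (a2 := T) (by simpa using e)]
    | succ n ih =>
      intro S e
      have hn : strands (T.1 ++ List.replicate n (cross s 0)) 2 = some 2 := by
        rw [strands_val_append T 2 _ le_rfl, strands_replicate_cross]
      have e' : S = glue ⟨_, hn⟩ (crossing s) :=
        Subtype.ext (by simp [e, glue_val, crossing, List.replicate_succ'])
      rw [e']
      exact (ih ⟨_, hn⟩ rfl).glue_crossing s
  exact key _ _ _ rfl

end IsSymmetric

theorem isSymmetric_rationalTangle (a : List ℤ) : IsSymmetric (rationalTangle a) := by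
  induction a using List.reverseRecOn with
  | nil => exact isSymmetric_idTangle
  | append_singleton a k ih =>
    have e : rationalTangle (a ++ [k]) = invert (glue (rationalTangle a) (halfTwists k)) := by
      simp [rationalTangle, List.foldl_append]
    rw [e]
    exact (ih.glue_halfTwists k).rotate.mirror

/-! ### Shifting a slope by one -/

theorem rationalTangle_append_one_zero (a : List ℤ) :
    rationalTangle (a ++ [1, 0]) = rotate (rotate (glue (rationalTangle a) (crossing true))) := by
  apply Subtype.ext
  have e : rationalTangle (a ++ [1, 0]) =
      invert (glue (invert (glue (rationalTangle a) (halfTwists 1))) (halfTwists 0)) := by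
    simp [rationalTangle, List.foldl_append]
  simp [e, invert, mirror_val, rotate_val, glue_val, halfTwists, crossing, Piece.mirror]

theorem slope_append_one_zero (a : List ℤ) :
    slope (a ++ [1, 0]) = ((slope a).2 + (slope a).1, (slope a).2) := by
  simp [slope, List.foldl_append]

/-- Insert a cancelling pair of half twists and absorb the positive one into the tangle by half-turn
invariance. -/
theorem iso_rationalTangle_append_one_zero (a : List ℤ) :
    Iso 2 2 (rationalTangle a).1 ((rationalTangle (a ++ [1, 0])).1 ++ [cross false 0]) := by
  rw [rationalTangle_append_one_zero]
  calc
    Iso 2 2 (rationalTangle a).1 ((rationalTangle a).1 ++ [cross true 0, cross false 0]) :=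
      (Iso.step (rationalTangle a).1 [] (.reidemeister_two true 0)).symm
    Iso 2 2 _ _ := Iso.ctx [] [cross false 0]
      ((isSymmetric_rationalTangle a).glue_crossing true).rotate_rotate.symm
        (by simp [glue_val, crossing])

/-- The link `L(A, R, C)` with half twists moved from the tangle `C` to the coefficient `e`. -/
theorem isotopic_threeTangleLink (A R : Tangle 2 2) (c : List ℤ) :
    Isotopic (threeTangleLink A R (rationalTangle c))
      (montesinosDiagram 1 [A, R, rationalTangle (c ++ [1, 0])]) := by
  -- For `e = 1` the twist region `halfTwists (-1)` is the single slice `cross false 0`, directly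
  -- above the third tangle.
  refine Iso.isotopic (Iso.ctx ([cup 0, cup 1] ++ A.1 ++ R.1) [cap 1, cap 0]
    ((iso_rationalTangle_append_one_zero c).map_shift 0 2) ?_ ?_)
  · simp [threeTangleLink, montesinosDiagram, closure, tangleSum, halfTwists, glue, idTangle]
  · simp [montesinosDiagram, closure, tangleSum, halfTwists, glue, idTangle]

/-! ### From isotopy to the third case: the numerical conditions. -/

theorem thirdCondition_of_lt (x y z : ℤ × ℤ)
    (h : (x.1 : ℚ) / x.2 < (z.1 : ℚ) / ((z.1 : ℚ) - z.2)) : ThirdCondition 1 [x, y, z] := by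
  refine ⟨rfl, (2 : Fin 3), min ((x.1 : ℚ) / x.2) ((y.1 : ℚ) / y.2), ⟨?_, ?_⟩,
    (min_le_left _ _).trans_lt h⟩
  · rcases min_choice ((x.1 : ℚ) / x.2) ((y.1 : ℚ) / y.2) with e | e
    · exact ⟨(0 : Fin 3), Fin.ne_of_val_ne (Nat.zero_ne_add_one 1), e⟩
    · exact ⟨(1 : Fin 3), Fin.ne_of_val_ne (Nat.succ_ne_succ_iff.2 (Nat.zero_ne_add_one 0)), e⟩
  · rintro t ⟨j, hj, rfl⟩
    change Fin 3 at j
    fin_cases j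
    · exact min_le_left _ _
    · exact min_le_right _ _
    · exact absurd rfl hj

/-- The link `L(A, R, C)` of rational tangles with slopes `a / x`, `β / α` and `-c / y`, where
`a / x`, `β / α` and `c / y` lie between `0` and `1` and `c / y` is larger than `a / x`. -/
theorem fallsIntoThirdCase_threeTangleLink {R : Tangle 2 2} {α β : ℤ}
    (hR : IsRationalTangle R α β) (hβ : 0 < β) (hβα : β < α) {l m : List ℤ} {x a y c : ℤ}
    (hl : slope l = (a, x)) (hm : slope m = (-c, y) ∨ slope m = (c, -y))
    (hx : IsCoprime x a) (hy : IsCoprime y c)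
    (ha : 0 < a) (hax : a < x) (hc : 0 < c) (hcy : c < y) (h : (x : ℚ) / a < (y : ℚ) / c) :
    FallsIntoThirdCase (threeTangleLink (rationalTangle l) R (rationalTangle m))
      [(x, a), (α, β), (y, y - c)] := by
  refine ⟨⟨[rationalTangle l, R, rationalTangle (m ++ [1, 0])], ?_,
    isotopic_threeTangleLink _ _ _⟩, ?_, thirdCondition_of_lt _ _ _ ?_⟩
  · refine .cons ⟨by simp only; omega, hx, l, rfl, .inl hl⟩
      (.cons hR (.cons ⟨?_, ?_, _, rfl, ?_⟩ .nil))
    · simp only; omega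
    · have := (hy.neg_right).add_mul_left_right 1
      rwa [mul_one, show -c + y = y - c by ring] at this
    · rw [slope_append_one_zero]
      rcases hm with hm | hm <;> rw [hm]
      · left; ext <;> simp; ring
      · right; ext <;> simp; ring
  · have key : ∀ p q : ℤ, 0 < q → q < p → 0 < (q : ℚ) / p ∧ (q : ℚ) / p < 1 := by
      intro p q hq hp
      have h1 : (0 : ℚ) < q := by exact_mod_cast hq
      have h2 : (q : ℚ) < p := by exact_mod_cast hp
      exact ⟨div_pos h1 (h1.trans h2), (div_lt_one (h1.trans h2)).2 h2⟩
    intro z hz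
    simp only [List.mem_cons, List.not_mem_nil, or_false] at hz
    rcases hz with rfl | rfl | rfl
    · exact key _ _ ha hax
    · exact key _ _ hβ hβα
    · exact key _ _ (by omega) (by omega)
  -- Here `y / (y - (y - c))` simplifies to `y / c`.
  · simpa using h

end Montesinos

/-! ### The four families. -/

theorem mainTheorem6 (R : Montesinos.Tangle 2 2) (α β : ℤ)
    (hR : Montesinos.IsRationalTangle R α β) (hβ : 0 < β) (hβα : β < α) :
    (∀ a₁ a₂ n : ℤ, 0 < a₁ → 0 < a₂ → 0 < n → 1 + a₁ * (a₂ - n) < 0 →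
      Montesinos.FallsIntoThirdCase
        (Montesinos.threeTangleLink (Montesinos.rationalTangle [a₁, a₂]) R
          (Montesinos.rationalTangle [-n]))
        [(a₁ * a₂ + 1, a₁), (α, β), (n, n - 1)]) ∧
    (∀ a₁ a₂ c₁ c₂ : ℤ, 0 < a₁ → 0 < a₂ → 0 < c₁ → 0 < c₂ → a₂ ≤ c₂ → c₁ < a₁ →
      Montesinos.FallsIntoThirdCase
        (Montesinos.threeTangleLink (Montesinos.rationalTangle [a₁, a₂]) R
          (Montesinos.rationalTangle [-c₁, -c₂]))
        [(a₁ * a₂ + 1, a₁), (α, β), (c₁ * c₂ + 1, c₁ * c₂ + 1 - c₁)]) ∧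
    (∀ a₁ a₂ a₃ n : ℤ, 0 < a₁ → 0 < a₂ → 0 < a₃ → 0 < n → a₃ < n →
      Montesinos.FallsIntoThirdCase
        (Montesinos.threeTangleLink (Montesinos.rationalTangle [a₁, a₂, a₃]) R
          (Montesinos.rationalTangle [-n]))
        [(a₁ * a₂ * a₃ + a₁ + a₃, a₁ * a₂ + 1), (α, β), (n, n - 1)]) ∧
    (∀ a₁ a₂ a₃ c₁ c₂ c₃ : ℤ, 0 < a₁ → 0 < a₂ → 0 < a₃ → 0 < c₁ → 0 < c₂ → 0 < c₃ →
      ((a₁ + a₃ + a₁ * a₂ * a₃ : ℤ) : ℚ) / ((c₁ + c₃ + c₁ * c₂ * c₃ : ℤ) : ℚ) <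
        ((1 + a₁ * a₂ : ℤ) : ℚ) / ((1 + c₁ * c₂ : ℤ) : ℚ) →
      Montesinos.FallsIntoThirdCase
        (Montesinos.threeTangleLink (Montesinos.rationalTangle [a₁, a₂, a₃]) R
          (Montesinos.rationalTangle [-c₁, -c₂, -c₃]))
        [(a₁ * a₂ * a₃ + a₁ + a₃, a₁ * a₂ + 1), (α, β),
          (c₁ * c₂ * c₃ + c₁ + c₃, c₁ * c₂ * c₃ + c₁ + c₃ - (c₁ * c₂ + 1))]) := by
  have cop2 (u v : ℤ) : IsCoprime (u * v + 1) u := ⟨1, -v, by ring⟩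
  have cop3 (u v w : ℤ) : IsCoprime (u * v * w + u + w) (u * v + 1) :=
    ⟨-v, v * w + 1, by ring⟩
  have lt2 (u v : ℤ) (hu : 0 < u) (hv : 0 < v) : u < u * v + 1 := by nlinarith
  have lt3 (u v w : ℤ) (hu : 0 < u) (hv : 0 < v) (hw : 0 < w) :
      u * v + 1 < u * v * w + u + w := by
    -- Over `ℤ`, `hw` is `0 + 1 ≤ w`, so the last hint says `0 ≤ u * v * (w - 1)`.
    nlinarith [mul_pos hu hv, mul_nonneg (mul_pos hu hv).le (Int.sub_nonneg_of_le hw)]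
  have slope2 (u v : ℤ) : Montesinos.slope [u, v] = (u, u * v + 1) := by
    simp [Montesinos.slope, mul_comm]
  have slope3 (u v w : ℤ) :
      Montesinos.slope [u, v, w] = (u * v + 1, u * v * w + u + w) := by
    ext <;> simp [Montesinos.slope] <;> ring
  refine ⟨?_, ?_, ?_, ?_⟩
  · intro a₁ a₂ n h₁ h₂ hn h
    have hn1 : 1 < n := by nlinarith
    refine Montesinos.fallsIntoThirdCase_threeTangleLink hR hβ hβα (c := 1) (slope2 a₁ a₂)
      (.inr (by simp [Montesinos.slope])) (cop2 _ _) isCoprime_one_right h₁ (lt2 _ _ h₁ h₂)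
      one_pos hn1 ?_
    rw [Int.cast_one, div_one, div_lt_iff₀ (by exact_mod_cast h₁)]
    exact_mod_cast (by linarith : a₁ * a₂ + 1 < n * a₁)
  · intro a₁ a₂ c₁ c₂ h₁ h₂ k₁ k₂ h h'
    refine Montesinos.fallsIntoThirdCase_threeTangleLink hR hβ hβα (slope2 a₁ a₂)
      (.inl ?_) (cop2 _ _) (cop2 _ _) h₁ (lt2 _ _ h₁ h₂) k₁ (lt2 _ _ k₁ k₂) ?_
    · rw [slope2, neg_mul_neg]
    · rw [div_lt_div_iff₀ (by exact_mod_cast h₁) (by exact_mod_cast k₁)]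
      -- After clearing denominators, `a₁ * c₁ * a₂ ≤ a₁ * c₁ * c₂` and `c₁ < a₁` add up to the
      -- claim.
      have := mul_le_mul_of_nonneg_left h (mul_pos h₁ k₁).le
      exact_mod_cast (by linarith : (a₁ * a₂ + 1) * c₁ < (c₁ * c₂ + 1) * a₁)
  · intro a₁ a₂ a₃ n h₁ h₂ h₃ hn h
    have ha := mul_pos h₁ h₂
    refine Montesinos.fallsIntoThirdCase_threeTangleLink hR hβ hβα (c := 1) (slope3 a₁ a₂ a₃)
      (.inr (by simp [Montesinos.slope])) (cop3 _ _ _) isCoprime_one_right (by linarith)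
      (lt3 _ _ _ h₁ h₂ h₃) one_pos (by linarith) ?_
    rw [Int.cast_one, div_one, div_lt_iff₀ (by exact_mod_cast (by linarith : 0 < a₁ * a₂ + 1))]
    -- Integrality gives `a₃ + 1 ≤ n`; the spare `a₁ * a₂ + 1` then exceeds `a₁`.
    have := mul_le_mul_of_nonneg_right (Int.add_one_le_of_lt h) (by linarith : 0 ≤ a₁ * a₂ + 1)
    have := lt2 a₁ a₂ h₁ h₂
    exact_mod_cast (by linarith : a₁ * a₂ * a₃ + a₁ + a₃ < n * (a₁ * a₂ + 1))
  · intro a₁ a₂ a₃ c₁ c₂ c₃ h₁ h₂ h₃ k₁ k₂ k₃ h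
    have ha := mul_pos h₁ h₂
    have hc := mul_pos k₁ k₂
    have ha' := lt3 _ _ _ h₁ h₂ h₃
    have hc' := lt3 _ _ _ k₁ k₂ k₃
    refine Montesinos.fallsIntoThirdCase_threeTangleLink hR hβ hβα (slope3 a₁ a₂ a₃)
      (.inr ?_) (cop3 _ _ _) (cop3 _ _ _) (by linarith) ha' (by linarith) hc' ?_
    · rw [slope3]
      ext <;> simp
      ring
    · rw [div_lt_div_iff₀ (by exact_mod_cast (by linarith : 0 < c₁ + c₃ + c₁ * c₂ * c₃))
        (by exact_mod_cast (by linarith : 0 < 1 + c₁ * c₂))] at h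
      rw [div_lt_div_iff₀ (by exact_mod_cast (by linarith : 0 < a₁ * a₂ + 1))
        (by exact_mod_cast (by linarith : 0 < c₁ * c₂ + 1))]
      have h' : (a₁ + a₃ + a₁ * a₂ * a₃) * (1 + c₁ * c₂) <
        (1 + a₁ * a₂) * (c₁ + c₃ + c₁ * c₂ * c₃) := by exact_mod_cast h
      exact_mod_cast (by linarith : (a₁ * a₂ * a₃ + a₁ + a₃) * (c₁ * c₂ + 1) <
        (c₁ * c₂ * c₃ + c₁ + c₃) * (a₁ * a₂ + 1))
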